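/- **Setting.** Let $\mathcal X$ be a compact metric space and let $P$ be a probability distribution on $\mathcal X\times\{+1,-1\}$. Let $k:\mathcal X^2\to\mathbb R$ be a continuous kernel with reproducing kernel Hilbert space $\mathcal H$, and let $K>0$ be a constant with $\sup_{x}\sqrt{k(x,x)}\le K$. Suppose that $k$ is universal, i.e. $\mathcal H$ is dense in the space of continuous functions on $\mathcal X$ with the supremum norm. Suppose that there is $\varepsilon_0>0$ with $P(\{x:\varepsilon_0\le P(+1|x)\le 1-\varepsilon_0\})>0$. Let $\ell:\mathbb R\to\mathbb R$ be non-decreasing, convex and non-negative, and such that for every $M>0$ there is $z_0$ with $g\ge M$ for all $z\ge z_0$ and all $g\in\partial\ell(z)$. Define $$\mathcal R(f,\rho)=-2\rho+\mathbb E[\ell(\rho-yf(x))]\in(-\infty,\infty],\qquad \mathcal R^*=\inf\{\mathcal R(f,\rho): f:\mathcal X\to\mathbb R\text{ measurable},\ \rho\in\mathbb R\}.$$ Let $(x_1,y_1),(x_2,y_2),\dots$ be i.i.d. with distribution $P$, and let $\lambda_m>0$ with $\lambda_m\to\infty$. For each sample size $m$ let $(\hat f,\hat b,\hat\rho)=(\hat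 f_m,\hat b_m,\hat\rho_m)$ be an optimal solution, whenever one exists (and an arbitrary element of $\mathcal H\times\mathbb R^2$ otherwise), of $$\min_{f\in\mathcal H,\ b,\rho\in\mathbb R}\ -2\rho+\frac1m\sum_{i=1}^m\ell(\rho-y_i(f(x_i)+b))\quad\text{subject to}\quad \|f\|_{\mathcal H}^2\le\lambda_m^2 .$$ **Theorem.** 1. $\mathcal R^*$ is finite, and there are constants $C,c>0$ and $M\in\mathbb N$, the same for every choice of the optimal solutions, such that for every $m\ge M$ $$\|\hat f\|_{\mathcal H}\le\lambda_m,\quad |\hat b|\le C\lambda_m,\quad |\hat\rho|\le C\lambda_m\qquad\text{with probability greater than } 1-e^{-cm}. \tag{1}$$ 2. Let $C>0$ be any constant for which (1) holds for some $c>0$ and $M$ and all $m\ge M$. Let $\kappa_m$ satisfy $|\ell(z)-\ell(z')|\le\kappa_m|z-z'|$ whenever $|z|,|z'|\le(K+2C)\lambda_m$, and put $b_m=4C\lambda_m+\ell((K+2C)\lambda_m)$. Let $\mathcal F_m=\{f\in\mathcal H:\|f\|_{\mathcal H}\le\lambda_m\}$ with the supremum norm, and let $\mathcal N(\mathcal F_m,r)$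 be the minimal number of closed balls of radius $r$ with centres in $\mathcal F_m$ that cover $\mathcal F_m$. Assume that for every $\varepsilon>0$ $$2\,\mathcal N\Big(\mathcal F_m,\frac{\varepsilon}{9(2+\kappa_m)}\Big)\Big(\frac{18C\lambda_m(2+\kappa_m)}{\varepsilon}\Big)^2\exp\Big\{-\frac{2m\varepsilon^2}{9b_m^2}\Big\}\longrightarrow 0\qquad(m\to\infty).$$ Then $\mathcal R(\hat f+\hat b,\hat\rho)$ converges to $\mathcal R^*$ in probability as $m\to\infty$. (Probabilities of possibly non-measurable events are understood as follows: the outer probability of the complementary, respectively exceptional, event is small.) -/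

import Mathlib

open MeasureTheory ProbabilityTheory Filter Topology
open scoped ENNReal NNReal

noncomputable section

namespace SurrogateRisk

/-- The numerical value of a label: `true` stands for the label `+1`, `false` for the label `-1`. -/
def label (y : Bool) : ℝ := if y then 1 else -1

/-! ### The loss function -/

/-- The subdifferential of `ℓ : ℝ → ℝ` at `z`. -/
def subdifferential (ℓ : ℝ → ℝ) (z : ℝ) : Set ℝ :=
  {g | ∀ w, ℓ z + g * (w - z) ≤ ℓ w}

/-- The basic assumptions on the loss: `ℓ` is non-decreasing, convex and non-negative, and its
subdifferential tends to infinity at infinity. -/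
structure IsBasicLoss (ℓ : ℝ → ℝ) : Prop where
  monotone : Monotone ℓ
  convex : ConvexOn ℝ Set.univ ℓ
  nonneg : ∀ z, 0 ≤ ℓ z
  subdifferential_tendsto :
    ∀ M : ℝ, 0 < M → ∃ z₀ : ℝ, ∀ z, z₀ ≤ z → ∀ g ∈ subdifferential ℓ z, M ≤ g

/-! ### The kernel and its reproducing kernel Hilbert space -/

section RKHS

variable {X : Type*} (H : Type*) [NormedAddCommGroup H] [InnerProductSpace ℝ H] [RKHS ℝ H X ℝ]

/-- The real-valued reproducing kernel `k(x, x')` of `H`. -/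
def kern [CompleteSpace H] (x x' : X) : ℝ := RKHS.kernel H x x' 1

/-- The ball `{f ∈ H : ‖f‖_H ≤ r}`, as a set of continuous functions with the supremum norm.
(All elements of `H` are continuous functions when the kernel is continuous.) -/
def supBall [TopologicalSpace X] (r : ℝ) : Set C(X, ℝ) :=
  {g | ∃ f : H, ‖f‖ ≤ r ∧ (g : X → ℝ) = f}

/-- The kernel of `H` is continuous, bounded by `K` in the sense that `sup_x √k(x,x) ≤ K`,
and universal: `H` is dense in the space of continuous functions for the supremum norm. -/
structure IsUniversalKernel [CompleteSpace H] [TopologicalSpace X] [CompactSpace X]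
    (K : ℝ) : Prop where
  continuous_kern : Continuous fun p : X × X => kern H p.1 p.2
  K_pos : 0 < K
  sqrt_kern_le : ∀ x : X, √(kern H x x) ≤ K
  universal : Dense {g : C(X, ℝ) | ∃ f : H, (g : X → ℝ) = f}

end RKHS

/-! ### The distribution of the data -/

section Risk

variable {X : Type*} [MeasurableSpace X]

/-- The non-deterministic assumption: for some `ε > 0`, the event
`ε ≤ P(+1 | x) ≤ 1 - ε` has positive probability under the marginal distribution of `x`. -/
def IsNonDeterministic (P : Measure (X × Bool)) [IsFiniteMeasure P] : Prop :=
  ∃ ε : ℝ, 0 < ε ∧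
    0 < P.fst {x | ε ≤ (P.condKernel x).real {true} ∧ (P.condKernel x).real {true} ≤ 1 - ε}

/-- The expected loss `R(f, ρ) = -2ρ + E[ℓ(ρ - y f(x))] ∈ (-∞, +∞]`, for non-negative `ℓ`. -/
def risk (P : Measure (X × Bool)) (ℓ : ℝ → ℝ) (f : X → ℝ) (ρ : ℝ) : EReal :=
  ((-2 * ρ : ℝ) : EReal) +
    ((∫⁻ z, ENNReal.ofReal (ℓ (ρ - label z.2 * f z.1)) ∂P : ℝ≥0∞) : EReal)

/-- `R^*`, the infimum of `R(f, ρ)` over all measurable `f` and all real `ρ`. -/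
def optRisk (P : Measure (X × Bool)) (ℓ : ℝ → ℝ) : EReal :=
  ⨅ (f : X → ℝ) (_ : Measurable f) (ρ : ℝ), risk P ℓ f ρ

end Risk

/-! ### The regularized empirical minimizer -/

section Estimator

variable {X : Type*}

/-- The empirical loss of `(f, ρ)` on the sample `T = ((x_i, y_i))_i`. -/
def empRisk {m : ℕ} (T : Fin m → X × Bool) (ℓ : ℝ → ℝ) (f : X → ℝ) (ρ : ℝ) : ℝ :=
  -2 * ρ + (1 / (m : ℝ)) * ∑ i, ℓ (ρ - label (T i).2 * f (T i).1)

variable {H : Type*} [NormedAddCommGroup H] [InnerProductSpace ℝ H] [RKHS ℝ H X ℝ]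

/-- `(f, b, ρ)` is an optimal solution of the minimization of the empirical loss of `(f + b, ρ)`
over `f ∈ H`, `b, ρ ∈ ℝ` subject to `‖f‖_H² ≤ r²`. -/
def IsMinimizer {m : ℕ} (T : Fin m → X × Bool) (ℓ : ℝ → ℝ) (r : ℝ) (f : H) (b ρ : ℝ) : Prop :=
  ‖f‖ ^ 2 ≤ r ^ 2 ∧
    ∀ (g : H) (c σ : ℝ), ‖g‖ ^ 2 ≤ r ^ 2 →
      empRisk T ℓ (fun x => f x + b) ρ ≤ empRisk T ℓ (fun x => g x + c) σ

variable {Ω : Type*}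

/-- The training sample formed by the first `m` data points. -/
def sample (Z : ℕ → Ω → X × Bool) (m : ℕ) (ω : Ω) : Fin m → X × Bool := fun i => Z i ω

/-- `(f̂, b̂, ρ̂)` is the regularized empirical minimizer: for every sample size `m` it is an
optimal solution of the problem with parameter `lam m` on the sample of size `m`. An optimal
solution need not exist if all labels in the sample agree; nothing is required in the case that
there is none. -/
def IsEstimator (Z : ℕ → Ω → X × Bool) (ℓ : ℝ → ℝ) (lam : ℕ → ℝ)
    (fhat : ℕ → Ω → H) (bhat rhohat : ℕ → Ω → ℝ) : Prop :=
  ∀ (m : ℕ) (ω : Ω),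
    (∃ (f : H) (b ρ : ℝ), IsMinimizer (sample Z m ω) ℓ (lam m) f b ρ) →
      IsMinimizer (sample Z m ω) ℓ (lam m) (fhat m ω) (bhat m ω) (rhohat m ω)

/-- For all `m ≥ M`, the bounds `‖f̂‖_H ≤ λ_m`, `|b̂| ≤ C λ_m`, `|ρ̂| ≤ C λ_m` hold with
probability greater than `1 - exp(-c m)`. (The probability of failure is an outer measure, so
that the estimator need not be measurable.) -/
def EstimatorBound [MeasurableSpace Ω] (μ : Measure Ω) (lam : ℕ → ℝ) (C c : ℝ) (M : ℕ)
    (fhat : ℕ → Ω → H) (bhat rhohat : ℕ → Ω → ℝ) : Prop :=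
  ∀ m, M ≤ m →
    μ {ω | ¬ (‖fhat m ω‖ ≤ lam m ∧ |bhat m ω| ≤ C * lam m ∧ |rhohat m ω| ≤ C * lam m)}
      < ENNReal.ofReal (Real.exp (-(c * m)))

end Estimator

/-! ### The uniform deviation bound -/

/-- For every `m`, `κ m` is a Lipschitz constant of `ℓ` on `|z| ≤ (K + 2C) λ_m`. -/
def IsLipschitzConst (ℓ : ℝ → ℝ) (K C : ℝ) (lam κ : ℕ → ℝ) : Prop :=
  ∀ (m : ℕ) (z z' : ℝ), |z| ≤ (K + 2 * C) * lam m → |z'| ≤ (K + 2 * C) * lam m →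
    |ℓ z - ℓ z'| ≤ κ m * |z - z'|

/-- `b_m = 4 C λ_m + ℓ((K + 2C) λ_m)`. -/
def lossRange (ℓ : ℝ → ℝ) (K C : ℝ) (lam : ℕ → ℝ) (m : ℕ) : ℝ :=
  4 * C * lam m + ℓ ((K + 2 * C) * lam m)

/-- The covering-number/Hoeffding bound
`2 N(F_m, ε / (9 (2 + κ_m))) (18 C λ_m (2 + κ_m) / ε)² exp(-2 m ε² / (9 b_m²))`,
where `F_m` is the ball of radius `λ_m` in `H` with the supremum norm. The covering number
`N` counts closed balls centred in `F_m`. -/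
def uniformBound {X : Type*} [TopologicalSpace X] [CompactSpace X] (H : Type*)
    [NormedAddCommGroup H] [InnerProductSpace ℝ H] [RKHS ℝ H X ℝ]
    (ℓ : ℝ → ℝ) (K C : ℝ) (lam κ : ℕ → ℝ) (ε : ℝ) (m : ℕ) : ℝ≥0∞ :=
  2 * (Metric.coveringNumber (Real.toNNReal (ε / (9 * (2 + κ m)))) (supBall H (lam m)) : ℝ≥0∞) *
    ENNReal.ofReal ((18 * C * lam m * (2 + κ m) / ε) ^ 2) *
    ENNReal.ofReal (Real.exp (-(2 * m * ε ^ 2 / (9 * lossRange ℓ K C lam m ^ 2))))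

end SurrogateRisk

end

noncomputable section

namespace SurrogateRisk

/-! ### Properties of the loss -/

/-! Non-determinism makes both labels carry mass at least some `p > 0`, so no decision function or
offset can lower the loss on both classes at once. Since `ℓ` dominates affine functions of every
slope, the loss then outgrows the gain `2ρ`. At the population level this bounds the risk below
(`optRisk_ne_bot`). On a sample where both labels are frequent, which fails with exponentially small
probability (`exists_balanced`), it confines any `(b, ρ)` that does at least as well as `0` to a box
of size linear in the bound on `f` (`exists_bound`). This gives both existence of minimizers and the
bound (1).

Consistency compares the estimator with one fixed `(h, σ)`, `h` in `H`, whose risk is nearly optimal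
(`exists_le_optRisk_add`: truncation, density of continuous functions in L¹, universality). Only two
one-sided deviations matter: the empirical risk must not underestimate the risk anywhere on the
parameter set (`measure_deviation_le`: a finite net, Hoeffding and a union bound), and must not
overestimate it at `(h, σ)` (`tendsto_measure_empRisk`). Optimality of the estimator links the two.
-/

lemma abs_label (y : Bool) : |label y| = 1 := by
  cases y <;> simp [label]

lemma measurable_label : Measurable label := Measurable.of_discrete

lemma abs_sub_label_mul_le (ρ t : ℝ) (y : Bool) : |ρ - label y * t| ≤ |ρ| + |t| := by
  simpa [abs_mul, abs_label] using abs_sub ρ (label y * t)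

/-- A convex function on the line has a subgradient at every point. -/
lemma subdifferential_nonempty {ℓ : ℝ → ℝ} (h : ConvexOn ℝ Set.univ ℓ) (z : ℝ) :
    (subdifferential ℓ z).Nonempty := by
  refine ⟨derivWithin ℓ (Set.Ioi z) z, fun w => ?_⟩
  have hz : z ∈ interior (Set.univ : Set ℝ) := by simp
  rcases lt_trichotomy w z with hw | rfl | hw
  · have h1 := (h.slope_le_leftDeriv_of_mem_interior (Set.mem_univ w) hz hw).trans
      (h.leftDeriv_le_rightDeriv_of_mem_interior hz)
    rw [slope_def_field, div_le_iff₀ (by linarith)] at h1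
    linarith
  · simp
  · have h1 := h.rightDeriv_le_slope_of_mem_interior hz (Set.mem_univ w) hw
    rw [slope_def_field, le_div_iff₀ (by linarith)] at h1
    linarith

namespace IsBasicLoss

variable {ℓ : ℝ → ℝ}

lemma continuous (hℓ : IsBasicLoss ℓ) : Continuous ℓ := hℓ.convex.locallyLipschitz.continuous

/-- The loss dominates affine functions of arbitrarily large slope. -/
lemma exists_mul_sub_le (hℓ : IsBasicLoss ℓ) {M : ℝ} (hM : 0 < M) :
    ∃ z₀ : ℝ, 0 ≤ z₀ ∧ ∀ w, M * (w - z₀) ≤ ℓ w := by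
  obtain ⟨z₁, hz₁⟩ := hℓ.subdifferential_tendsto M hM
  obtain ⟨g, hg⟩ := subdifferential_nonempty hℓ.convex (max z₁ 0)
  have hMg := hz₁ _ (le_max_left _ _) g hg
  refine ⟨max z₁ 0, le_max_right _ _, fun w => ?_⟩
  rcases le_total w (max z₁ 0) with hw | hw
  · exact (mul_nonpos_of_nonneg_of_nonpos hM.le (by linarith)).trans (hℓ.nonneg w)
  · have h1 := hg w
    have h2 := hℓ.nonneg (max z₁ 0)
    have h3 := mul_le_mul_of_nonneg_right hMg (sub_nonneg.2 hw)
    linarith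

lemma two_mul_le (hℓ : IsBasicLoss ℓ) (ρ t : ℝ) : 2 * ℓ ρ ≤ ℓ (ρ - t) + ℓ (ρ + t) := by
  have h := hℓ.convex.2 (Set.mem_univ (ρ - t)) (Set.mem_univ (ρ + t))
    (by norm_num : (0 : ℝ) ≤ 1 / 2) (by norm_num : (0 : ℝ) ≤ 1 / 2) (by norm_num)
  simp only [smul_eq_mul] at h
  rw [show 1 / 2 * (ρ - t) + 1 / 2 * (ρ + t) = ρ by ring] at h
  linarith

lemma exists_lipschitz (hℓ : IsBasicLoss ℓ) (B : ℝ) :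
    ∃ L : ℝ, 0 ≤ L ∧ ∀ z z', |z| ≤ B → |z'| ≤ B → |ℓ z - ℓ z'| ≤ L * |z - z'| := by
  obtain ⟨L, hL⟩ := LocallyLipschitzOn.exists_lipschitzOnWith_of_compact
    (isCompact_Icc (a := -B) (b := B)) (hℓ.convex.locallyLipschitz.locallyLipschitzOn)
  refine ⟨L, L.2, fun z z' hz hz' => ?_⟩
  simpa [Real.dist_eq] using hL.dist_le_mul z (abs_le.1 hz) z' (abs_le.1 hz')

end IsBasicLoss

/-! ### Elements of the reproducing kernel Hilbert space -/

section Kernel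

variable {X : Type*} {H : Type*} [NormedAddCommGroup H] [InnerProductSpace ℝ H] [CompleteSpace H]
  [RKHS ℝ H X ℝ]

lemma apply_eq_inner_kerFun (f : H) (x : X) : f x = inner ℝ (RKHS.kerFun H x 1) f := by
  simp

lemma kern_eq_inner (x x' : X) :
    kern H x x' = inner ℝ (RKHS.kerFun H x 1) (RKHS.kerFun H x' 1) := by
  rw [kern, ← apply_eq_inner_kerFun, RKHS.kerFun_apply]

variable [TopologicalSpace X] [CompactSpace X] {K : ℝ}

/-- The reproducing property and Cauchy–Schwarz, with `‖k_x‖ = √k(x,x)`. -/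
lemma IsUniversalKernel.abs_apply_le (hk : IsUniversalKernel H K) (f : H) (x : X) :
    |f x| ≤ K * ‖f‖ := by
  have h := hk.sqrt_kern_le x
  rw [kern_eq_inner, ← norm_eq_sqrt_real_inner] at h
  rw [apply_eq_inner_kerFun]
  exact (abs_real_inner_le_norm _ _).trans (mul_le_mul_of_nonneg_right h (norm_nonneg f))

/-- The expansion `‖k_y - k_x‖² = k(y,y) - 2k(y,x) + k(x,x)` is continuous in `y` and vanishes at `y
= x`. Continuity, hence measurability, of all elements of `H` follows. -/
lemma IsUniversalKernel.continuous_kerFun (hk : IsUniversalKernel H K) :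
    Continuous fun x : X => RKHS.kerFun H x (1 : ℝ) := by
  have hc := hk.continuous_kern
  rw [continuous_iff_continuousAt]
  intro x
  rw [ContinuousAt, tendsto_iff_norm_sub_tendsto_zero]
  have h1 : Continuous fun y : X => kern H y y - 2 * kern H y x + kern H x x := by
    have h2 : Continuous fun y : X => kern H y y :=
      Continuous.comp (f := fun y : X => (y, y)) hc (by fun_prop)
    have h3 : Continuous fun y : X => kern H y x :=
      Continuous.comp (f := fun y : X => (y, x)) hc (by fun_prop)
    exact (h2.sub (continuous_const.mul h3)).add continuous_const
  have h4 := (h1.tendsto x).sqrt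
  rw [show kern H x x - 2 * kern H x x + kern H x x = 0 by ring, Real.sqrt_zero] at h4
  refine h4.congr fun y => ?_
  rw [kern_eq_inner, kern_eq_inner, kern_eq_inner, real_inner_self_eq_norm_sq,
    real_inner_self_eq_norm_sq, ← norm_sub_sq_real, Real.sqrt_sq (norm_nonneg _)]

lemma IsUniversalKernel.continuous_coe (hk : IsUniversalKernel H K) (f : H) :
    Continuous (f : X → ℝ) := by
  have h : (f : X → ℝ) = fun x => inner ℝ (RKHS.kerFun H x 1) f :=
    funext (apply_eq_inner_kerFun f)
  rw [h]
  exact hk.continuous_kerFun.inner continuous_const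

end Kernel

/-! ### The loss of a bounded decision function -/

section PopRisk

variable {X : Type*}

/-- The contribution of a data point to the loss of `(f, ρ)`. -/
def lossFn (ℓ : ℝ → ℝ) (f : X → ℝ) (ρ : ℝ) (z : X × Bool) : ℝ :=
  -2 * ρ + ℓ (ρ - label z.2 * f z.1)

lemma empRisk_eq {m : ℕ} (hm : m ≠ 0) (T : Fin m → X × Bool) (ℓ : ℝ → ℝ) (f : X → ℝ) (ρ : ℝ) :
    empRisk T ℓ f ρ = (1 / (m : ℝ)) * ∑ i, lossFn ℓ f ρ (T i) := by
  have : (m : ℝ) ≠ 0 := by exact_mod_cast hm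
  simp only [empRisk, lossFn, Finset.sum_add_distrib, Finset.sum_const, Finset.card_univ,
    Fintype.card_fin, nsmul_eq_mul]
  field_simp

variable {ℓ : ℝ → ℝ}

lemma IsBasicLoss.lossFn_mem_Icc (hℓ : IsBasicLoss ℓ) {f : X → ℝ} {B R : ℝ} {ρ : ℝ}
    (hρ : |ρ| ≤ R) (hf : ∀ x, |f x| ≤ B) (z : X × Bool) :
    lossFn ℓ f ρ z ∈ Set.Icc (-2 * R) (2 * R + ℓ (R + B)) := by
  have h1 := hℓ.nonneg (ρ - label z.2 * f z.1)
  have h2 : ρ - label z.2 * f z.1 ≤ R + B :=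
    (le_abs_self _).trans ((abs_sub_label_mul_le _ _ _).trans (add_le_add hρ (hf _)))
  have h3 := hℓ.monotone h2
  have h4 := abs_le.1 hρ
  unfold lossFn
  constructor <;> linarith

variable [MeasurableSpace X]

lemma IsBasicLoss.measurable_loss (hℓ : IsBasicLoss ℓ) {f : X → ℝ} (hf : Measurable f) (ρ : ℝ) :
    Measurable fun z : X × Bool => ℓ (ρ - label z.2 * f z.1) :=
  hℓ.continuous.measurable.comp (measurable_const.sub
    ((measurable_label.comp measurable_snd).mul (hf.comp measurable_fst)))

lemma IsBasicLoss.measurable_lossFn (hℓ : IsBasicLoss ℓ) {f : X → ℝ} (hf : Measurable f) (ρ : ℝ) :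
    Measurable (lossFn ℓ f ρ) :=
  (hℓ.measurable_loss hf ρ).const_add _

variable (P : Measure (X × Bool)) [IsProbabilityMeasure P]

lemma IsBasicLoss.integrable_lossFn (hℓ : IsBasicLoss ℓ) {f : X → ℝ} (hf : Measurable f)
    {B : ℝ} (hB : ∀ x, |f x| ≤ B) (ρ : ℝ) : Integrable (lossFn ℓ f ρ) P :=
  Integrable.of_mem_Icc _ _ (hℓ.measurable_lossFn hf ρ).aemeasurable
    (Eventually.of_forall (hℓ.lossFn_mem_Icc le_rfl hB))

/-- Passage from extended-real risks to Bochner integrals, in which the approximation and deviation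
estimates are carried out. -/
lemma IsBasicLoss.risk_eq (hℓ : IsBasicLoss ℓ) {f : X → ℝ} {ρ : ℝ}
    (hf : Integrable (lossFn ℓ f ρ) P) :
    risk P ℓ f ρ = ((∫ z, lossFn ℓ f ρ z ∂P : ℝ) : EReal) := by
  have hint : Integrable (fun z : X × Bool => ℓ (ρ - label z.2 * f z.1)) P := by
    refine ((integrable_const (2 * ρ)).add hf).congr (Eventually.of_forall fun z => ?_)
    simp [lossFn]
  have h0 : 0 ≤ ∫ z, ℓ (ρ - label z.2 * f z.1) ∂P := integral_nonneg fun z => hℓ.nonneg _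
  rw [risk, ← ofReal_integral_eq_lintegral_ofReal hint
    (Eventually.of_forall fun z => hℓ.nonneg _)]
  simp only [lossFn]
  rw [integral_add (integrable_const _) hint, EReal.coe_ennreal_ofReal, max_eq_left h0]
  simp

/-! ### Both labels carry mass -/

/-- Under the non-deterministic assumption, the expectation of a non-negative function dominates
a fixed fraction of any lower bound for the sum of its values over the two labels. -/
lemma IsNonDeterministic.exists_mass {P : Measure (X × Bool)} [IsProbabilityMeasure P]
    (hP : IsNonDeterministic P) :
    ∃ p : ℝ, 0 < p ∧ ∀ F : X × Bool → ℝ≥0∞, Measurable F → ∀ c : ℝ≥0∞,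
      (∀ x, c ≤ F (x, true) + F (x, false)) → ENNReal.ofReal p * c ≤ ∫⁻ z, F z ∂P := by
  obtain ⟨ε, hε, hA⟩ := hP
  set A := {x | ε ≤ (P.condKernel x).real {true} ∧ (P.condKernel x).real {true} ≤ 1 - ε} with hAdef
  have hmeas : Measurable fun x => (P.condKernel x).real {true} :=
    (P.condKernel.measurable_coe (measurableSet_singleton true)).ennreal_toReal
  have hAm : MeasurableSet A :=
    (measurableSet_le measurable_const hmeas).inter (measurableSet_le hmeas measurable_const)
  -- On `A` each label has conditional probability at least `ε`, so integrating over `A` alone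
  -- yields the fraction `ε P(A)`.
  refine ⟨ε * (P.fst A).toReal, mul_pos hε (ENNReal.toReal_pos hA.ne' (measure_ne_top _ _)),
    fun F hF c hc => ?_⟩
  rw [← Measure.lintegral_condKernel hF, ENNReal.ofReal_mul hε.le,
    ENNReal.ofReal_toReal (measure_ne_top _ _)]
  calc ENNReal.ofReal ε * P.fst A * c = ∫⁻ _ in A, ENNReal.ofReal ε * c ∂P.fst := by
        rw [setLIntegral_const]; ring
    _ ≤ ∫⁻ x in A, ∫⁻ y, F (x, y) ∂P.condKernel x ∂P.fst := by
        refine setLIntegral_mono' hAm fun x hx => ?_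
        have h1 : ENNReal.ofReal ε ≤ P.condKernel x {true} := by
          rw [ENNReal.ofReal_le_iff_le_toReal (measure_ne_top _ _)]; exact hx.1
        have h2 : ENNReal.ofReal ε ≤ P.condKernel x {false} := by
          rw [ENNReal.ofReal_le_iff_le_toReal (measure_ne_top _ _)]
          have h3 : ({false} : Set Bool) = {true}ᶜ := by ext b; cases b <;> simp
          have h4 := probReal_compl_eq_one_sub (μ := P.condKernel x) (measurableSet_singleton true)
          rw [h3]
          change ε ≤ (P.condKernel x).real {true}ᶜ
          linarith [hx.2]
        rw [lintegral_fintype, Fintype.sum_bool]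
        calc ENNReal.ofReal ε * c ≤ ENNReal.ofReal ε * (F (x, true) + F (x, false)) := by
              gcongr; exact hc x
          _ = F (x, true) * ENNReal.ofReal ε + F (x, false) * ENNReal.ofReal ε := by ring
          _ ≤ _ := by gcongr
    _ ≤ _ := setLIntegral_le_lintegral _ _

end PopRisk

/-! ### Finiteness of the optimal risk -/

section OptRisk

variable {X : Type*} [MeasurableSpace X] {ℓ : ℝ → ℝ} {P : Measure (X × Bool)}
  [IsProbabilityMeasure P]

lemma optRisk_le (P : Measure (X × Bool)) (ℓ : ℝ → ℝ) {f : X → ℝ} (hf : Measurable f) (ρ : ℝ) :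
    optRisk P ℓ ≤ risk P ℓ f ρ :=
  iInf_le_of_le f (iInf_le_of_le hf (iInf_le _ ρ))

lemma IsBasicLoss.optRisk_ne_top (hℓ : IsBasicLoss ℓ) : optRisk P ℓ ≠ ⊤ := by
  have h := optRisk_le P ℓ (f := fun _ => 0) measurable_const 0
  rw [hℓ.risk_eq P (hℓ.integrable_lossFn P measurable_const (B := 0) (by simp) 0)] at h
  exact ne_top_of_le_ne_top (EReal.coe_ne_top _) h

/-- Midpoint convexity eliminates `f` from the sum over the two labels, so the risk is at least `-2ρ
+ 2pℓ(ρ)`. An affine minorant of `ℓ` of slope `1/p` cancels the linear term and leaves `-2z₀`. -/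
lemma IsBasicLoss.optRisk_ne_bot (hℓ : IsBasicLoss ℓ) (hP : IsNonDeterministic P) :
    optRisk P ℓ ≠ ⊥ := by
  obtain ⟨p, hp, hmass⟩ := hP.exists_mass
  obtain ⟨z₀, -, hz₀⟩ := hℓ.exists_mul_sub_le (M := 1 / p) (by positivity)
  refine ne_bot_of_le_ne_bot (EReal.coe_ne_bot (-2 * z₀)) ?_
  refine le_iInf fun f => le_iInf fun hf => le_iInf fun ρ => ?_
  have h1 := hmass (fun z => ENNReal.ofReal (ℓ (ρ - label z.2 * f z.1)))
    (hℓ.measurable_loss hf ρ).ennreal_ofReal (ENNReal.ofReal (2 * ℓ ρ)) (fun x => by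
      rw [← ENNReal.ofReal_add (hℓ.nonneg _) (hℓ.nonneg _)]
      apply ENNReal.ofReal_le_ofReal
      simpa [label] using hℓ.two_mul_le ρ (f x))
  rw [← ENNReal.ofReal_mul hp.le] at h1
  have h2 : (p * (2 * ℓ ρ) : ℝ) ≤
      (((∫⁻ z, ENNReal.ofReal (ℓ (ρ - label z.2 * f z.1)) ∂P : ℝ≥0∞)) : EReal) := by
    have h3 := EReal.coe_ennreal_le_coe_ennreal_iff.2 h1
    rwa [EReal.coe_ennreal_ofReal,
      max_eq_left (mul_nonneg hp.le (mul_nonneg two_pos.le (hℓ.nonneg ρ)))] at h3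
  refine le_trans ?_ (add_le_add_right h2 _)
  rw [← EReal.coe_add, EReal.coe_le_coe_iff]
  have h4 := mul_le_mul_of_nonneg_left (hz₀ ρ) hp.le
  rw [← mul_assoc, mul_one_div_cancel hp.ne', one_mul] at h4
  linarith

end OptRisk

/-! ### Samples in which both labels occur frequently -/

section Balanced

variable {X : Type*}

/-- Each label occurs in the sample with frequency at least `p`. -/
def IsBalanced {m : ℕ} (p : ℝ) (T : Fin m → X × Bool) : Prop :=
  ∀ y : Bool, p * m ≤ ((Finset.univ.filter fun i => (T i).2 = y).card : ℝ)

/-- An offset hurts the class of the opposite sign: there `-y c = |c|`, and that class contains at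
least `p * m` points. The other class is discarded because `ℓ` is non-negative. -/
lemma IsBalanced.le_empRisk {m : ℕ} (hm : m ≠ 0) {p : ℝ} {T : Fin m → X × Bool}
    (hT : IsBalanced p T) {ℓ : ℝ → ℝ} (hℓ : IsBasicLoss ℓ) {g : X → ℝ} {B : ℝ}
    (hg : ∀ x, |g x| ≤ B) (c σ : ℝ) :
    -2 * σ + p * ℓ (σ - B + |c|) ≤ empRisk T ℓ (fun x => g x + c) σ := by
  have hm' : (0 : ℝ) < m := by exact_mod_cast Nat.pos_of_ne_zero hm
  obtain ⟨y, hy⟩ : ∃ y, -(label y * c) = |c| := by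
    rcases le_total 0 c with h | h
    · exact ⟨false, by simp [label, abs_of_nonneg h]⟩
    · exact ⟨true, by simp [label, abs_of_nonpos h]⟩
  have h1 : p * m * ℓ (σ - B + |c|) ≤ ∑ i, ℓ (σ - label (T i).2 * (g (T i).1 + c)) := by
    calc p * m * ℓ (σ - B + |c|)
        ≤ ((Finset.univ.filter fun i => (T i).2 = y).card : ℝ) * ℓ (σ - B + |c|) :=
          mul_le_mul_of_nonneg_right (hT y) (hℓ.nonneg _)
      _ = ∑ i ∈ Finset.univ.filter (fun i => (T i).2 = y), ℓ (σ - B + |c|) := by simp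
      _ ≤ ∑ i ∈ Finset.univ.filter (fun i => (T i).2 = y),
            ℓ (σ - label (T i).2 * (g (T i).1 + c)) := by
          refine Finset.sum_le_sum fun i hi => hℓ.monotone ?_
          rw [(Finset.mem_filter.1 hi).2]
          have h2 : label y * g (T i).1 ≤ B := by
            refine (le_abs_self _).trans ?_
            rw [abs_mul, abs_label, one_mul]
            exact hg _
          linarith
      _ ≤ _ := Finset.sum_le_univ_sum_of_nonneg fun i => hℓ.nonneg _
  unfold empRisk
  have h3 : p * ℓ (σ - B + |c|) =
      (1 / (m : ℝ)) * (p * m * ℓ (σ - B + |c|)) := by field_simp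
  rw [h3]
  gcongr

/-- On balanced samples, parameters that do at least as well as `0` are bounded. -/
lemma IsBasicLoss.exists_bound (hℓ : IsBasicLoss ℓ) {p : ℝ} (hp : 0 < p) :
    ∃ D : ℝ, 0 ≤ D ∧ ∀ {m : ℕ} (_ : m ≠ 0) {T : Fin m → X × Bool} (_ : IsBalanced p T)
      {g : X → ℝ} {B : ℝ} (_ : ∀ x, |g x| ≤ B) {c σ : ℝ},
      empRisk T ℓ (fun x => g x + c) σ ≤ ℓ 0 → 0 ≤ B → |c| ≤ 2 * B + D ∧ |σ| ≤ 2 * B + D := by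
  -- Any slope above `2 / p` beats `-2σ`. With `4 / p` one gets `2σ + 4|c| ≤ 4(B + z₀) + ℓ 0`, while
  -- non-negativity of `ℓ` gives `-2σ ≤ ℓ 0`.
  obtain ⟨z₀, hz, hz₀⟩ := hℓ.exists_mul_sub_le (M := 4 / p) (by positivity)
  have hℓ0 := hℓ.nonneg 0
  refine ⟨2 * z₀ + ℓ 0, by positivity, fun {m} hm {T} hT {g B} hg {c σ} h hB => ?_⟩
  have h1 := hT.le_empRisk hm hℓ hg c σ
  have h2 := mul_le_mul_of_nonneg_left (hz₀ (σ - B + |c|)) hp.le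
  rw [← mul_assoc, mul_div_cancel₀ _ hp.ne'] at h2
  have h3 : -2 * σ ≤ ℓ 0 := by
    have h4 := mul_nonneg hp.le (hℓ.nonneg (σ - B + |c|))
    linarith
  have h5 := abs_nonneg c
  refine ⟨by linarith, abs_le.2 ⟨by linarith, by linarith⟩⟩

end Balanced

/-! ### Existence of a minimizer -/

section Minimizer

lemma empRisk_zero {X H : Type*} [NormedAddCommGroup H] [InnerProductSpace ℝ H] [RKHS ℝ H X ℝ]
    {m : ℕ} (hm : m ≠ 0) (T : Fin m → X × Bool) (ℓ : ℝ → ℝ) :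
    empRisk T ℓ (fun x => (0 : H) x + 0) 0 = ℓ 0 := by
  have : (m : ℝ) ≠ 0 := by exact_mod_cast hm
  simp [empRisk, this]

variable {X : Type*} {H : Type*} [NormedAddCommGroup H] [InnerProductSpace ℝ H] [CompleteSpace H]
  [RKHS ℝ H X ℝ]

/-- Values at finitely many points can be attained in the span of the kernel functions without
increasing the norm. -/
lemma exists_mem_span_kerFun {m : ℕ} (x : Fin m → X) (g : H) :
    ∃ g' ∈ Submodule.span ℝ (Set.range fun i => RKHS.kerFun H (x i) (1 : ℝ)),
      ‖g'‖ ≤ ‖g‖ ∧ ∀ i, g' (x i) = g (x i) := by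
  set V := Submodule.span ℝ (Set.range fun i => RKHS.kerFun H (x i) (1 : ℝ)) with hV
  have : FiniteDimensional ℝ V := FiniteDimensional.span_of_finite ℝ (Set.finite_range _)
  -- The residual of the orthogonal projection is orthogonal to every `k_{x_i}`, that is, it
  -- vanishes at every `x_i`.
  refine ⟨V.orthogonalProjectionOnto g, Submodule.coe_mem _, V.norm_orthogonalProjectionOnto_apply_le g,
    fun i => ?_⟩
  have h := V.sub_starProjection_mem_orthogonal g _
    (Submodule.subset_span (Set.mem_range_self i))
  rw [Submodule.starProjection_apply] at h
  rw [inner_sub_right, ← apply_eq_inner_kerFun, ← apply_eq_inner_kerFun] at h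
  linarith

/-- The ball of `H` need not be compact, but projection onto the span of the sample's kernel
functions makes the problem finite-dimensional in `f`, and balance bounds the competitive `b` and
`ρ`. A continuous objective on a compact set then attains its minimum. -/
lemma IsBasicLoss.exists_isMinimizer [TopologicalSpace X] [CompactSpace X] {K : ℝ}
    (hk : IsUniversalKernel H K) {ℓ : ℝ → ℝ} (hℓ : IsBasicLoss ℓ) {p : ℝ} (hp : 0 < p)
    {m : ℕ} (hm : m ≠ 0) {T : Fin m → X × Bool} (hT : IsBalanced p T) {r : ℝ} (hr : 0 < r) :
    ∃ (f : H) (b ρ : ℝ), IsMinimizer T ℓ r f b ρ := by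
  obtain ⟨D, hD0, hD⟩ := hℓ.exists_bound (X := X) hp
  set V := Submodule.span ℝ (Set.range fun i => RKHS.kerFun H (T i).1 (1 : ℝ)) with hV
  have : FiniteDimensional ℝ V := FiniteDimensional.span_of_finite ℝ (Set.finite_range _)
  have : ProperSpace V := FiniteDimensional.proper ℝ V
  set A := 2 * (K * r) + D
  have hKr : 0 ≤ K * r := mul_nonneg hk.K_pos.le hr.le
  have hA : 0 ≤ A := by positivity
  set S : Set (V × ℝ × ℝ) :=
    Metric.closedBall 0 r ×ˢ (Set.Icc (-A) A ×ˢ Set.Icc (-A) A) with hS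
  have hScomp : IsCompact S :=
    (isCompact_closedBall _ _).prod (isCompact_Icc.prod isCompact_Icc)
  have h0 : ((0, 0, 0) : V × ℝ × ℝ) ∈ S := by simp [hS, hr.le, hA]
  have hcont : Continuous fun q : V × ℝ × ℝ =>
      empRisk T ℓ (fun x => (q.1 : H) x + q.2.1) q.2.2 := by
    have hev : ∀ i, Continuous fun q : V × ℝ × ℝ => (q.1 : H) (T i).1 := fun i =>
      (RKHS.continuous_eval (T i).1).comp (continuous_subtype_val.comp continuous_fst)
    unfold empRisk
    refine Continuous.add (by fun_prop) (continuous_const.mul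
      (continuous_finsetSum _ fun i _ => hℓ.continuous.comp ?_))
    have := hev i
    fun_prop
  obtain ⟨q, hqS, hq⟩ := hScomp.exists_isMinOn ⟨_, h0⟩ hcont.continuousOn
  have hq1 : ‖(q.1 : H)‖ ≤ r := by simpa using hqS.1
  refine ⟨q.1, q.2.1, q.2.2, pow_le_pow_left₀ (norm_nonneg _) hq1 2, fun g c σ hg => ?_⟩
  have hg' : ‖g‖ ≤ r := le_of_sq_le_sq hg hr.le
  -- A competitor at least as good as `0` has a projected copy in `S` with the same objective; a
  -- worse one loses to `0`, which lies in `S`.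
  rcases le_total (empRisk T ℓ (fun x => g x + c) σ) (ℓ 0) with h | h
  · obtain ⟨hc, hσ⟩ := hD hm hT (B := K * r) (fun x => (hk.abs_apply_le g x).trans
      (mul_le_mul_of_nonneg_left hg' hk.K_pos.le)) h hKr
    obtain ⟨g', hg'V, hg'n, hg'e⟩ := exists_mem_span_kerFun (fun i => (T i).1) g
    have h1 := hq (a := (⟨g', hg'V⟩, c, σ)) (by
      refine ⟨?_, abs_le.1 hc, abs_le.1 hσ⟩
      simpa using hg'n.trans hg')
    simp only [Set.mem_ofPred_eq] at h1
    refine h1.trans (le_of_eq ?_)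
    simp only [empRisk]
    simp [hg'e]
  · have h1 := hq h0
    simp only [Set.mem_ofPred_eq, ZeroMemClass.coe_zero] at h1
    rw [empRisk_zero hm] at h1
    exact h1.trans h

end Minimizer

/-! ### Concentration -/

section Hoeffding

variable {X : Type*} [MeasurableSpace X] {P : Measure (X × Bool)} {Ω : Type*} [MeasurableSpace Ω]
  {μ : Measure Ω} [IsProbabilityMeasure μ] {Z : ℕ → Ω → X × Bool}

lemma hoeffding_sample (hZ_meas : ∀ i, Measurable (Z i)) (hZ_indep : iIndepFun Z μ)
    (hZ_law : ∀ i, μ.map (Z i) = P) {U : X × Bool → ℝ} (hU : Measurable U) {a b : ℝ}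
    (hab : ∀ z, U z ∈ Set.Icc a b) {t : ℝ} (ht : 0 ≤ t) (m : ℕ) :
    μ {ω | t * m ≤ ∑ i, (∫ z, U z ∂P - U (sample Z m ω i))} ≤
      ENNReal.ofReal (Real.exp (-(2 * m * t ^ 2 / (b - a) ^ 2))) := by
  have hint : ∀ i, μ[fun ω => -U (Z i ω)] = -∫ z, U z ∂P := fun i => by
    rw [integral_neg, ← hZ_law i, integral_map (hZ_meas i).aemeasurable hU.aestronglyMeasurable]
  -- The signs are reversed because the event concerns the lower tail of `U`.
  have hind : iIndepFun (fun i ω => -U (Z i ω) - μ[fun ω => -U (Z i ω)]) μ :=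
    hZ_indep.comp (fun i z => -U z - ∫ ω, -U (Z i ω) ∂μ) (fun i => hU.neg.sub_const _)
  have h := HasSubgaussianMGF.measure_sum_range_ge_le_of_iIndepFun hind
    (n := m) (fun i _ => hasSubgaussianMGF_of_mem_Icc (hU.comp (hZ_meas i)).neg.aemeasurable
      (Eventually.of_forall fun ω => ⟨neg_le_neg (hab _).2, neg_le_neg (hab _).1⟩))
    (mul_nonneg ht (Nat.cast_nonneg m))
  have hset : {ω | t * m ≤ ∑ i, (∫ z, U z ∂P - U (sample Z m ω i))} =
      {ω | t * m ≤ ∑ i ∈ Finset.range m, (-U (Z i ω) - μ[fun ω => -U (Z i ω)])} := by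
    ext ω
    simp only [Set.mem_ofPred_eq, hint, Finset.sum_range, sample]
    simp only [sub_neg_eq_add, neg_add_eq_sub]
  rw [hset, ← ENNReal.ofReal_toReal (measure_ne_top μ _)]
  refine ENNReal.ofReal_le_ofReal (h.trans (le_of_eq ?_))
  congr 1
  push_cast
  rw [Real.norm_eq_abs, div_pow, sq_abs, show -a - -b = b - a by ring]
  -- In the degenerate cases `m = 0` and `b = a` both exponents are `0`, using the convention `x / 0
  -- = 0`.
  rcases eq_or_ne m 0 with rfl | hm
  · simp
  rcases eq_or_ne (b - a) 0 with h0 | h0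
  · simp [h0]
  have : (m : ℝ) ≠ 0 := by exact_mod_cast hm
  field_simp

/-- Samples are balanced with exponentially high probability. -/
lemma IsNonDeterministic.exists_balanced [IsProbabilityMeasure P] (hP : IsNonDeterministic P)
    (hZ_meas : ∀ i, Measurable (Z i)) (hZ_indep : iIndepFun Z μ)
    (hZ_law : ∀ i, μ.map (Z i) = P) :
    ∃ p : ℝ, 0 < p ∧ ∃ c : ℝ, 0 < c ∧ ∀ᶠ m : ℕ in atTop,
      μ {ω | ¬ IsBalanced p (sample Z m ω)} < ENNReal.ofReal (Real.exp (-(c * m))) := by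
  obtain ⟨p, hp, hmass⟩ := hP.exists_mass
  -- Each label has probability at least `p`, so a frequency below `p / 2` is a deviation of `p /
  -- 2`. Hoeffding's rate is `2 (p / 2) ^ 2`; half of it absorbs the factor `2` from the union over
  -- labels.
  refine ⟨p / 2, by positivity, (p / 2) ^ 2, by positivity, ?_⟩
  set U : Bool → X × Bool → ℝ := fun y z => if z.2 = y then 1 else 0 with hU
  have hUm : ∀ y, Measurable (U y) := fun y =>
    Measurable.ite (measurable_snd (measurableSet_singleton y)) measurable_const measurable_const
  have hUb : ∀ y z, U y z ∈ Set.Icc (0 : ℝ) 1 := fun y z => by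
    simp only [hU]; split_ifs <;> simp
  have hUi : ∀ y, p ≤ ∫ z, U y z ∂P := fun y => by
    have h1 := hmass (fun z => ENNReal.ofReal (U y z)) (hUm y).ennreal_ofReal 1
      (fun x => by cases y <;> simp [hU])
    rw [mul_one, ← ofReal_integral_eq_lintegral_ofReal (Integrable.of_mem_Icc 0 1
      (hUm y).aemeasurable (Eventually.of_forall (hUb y)))
      (Eventually.of_forall fun z => (hUb y z).1)] at h1
    exact (ENNReal.ofReal_le_ofReal_iff (integral_nonneg fun z => (hUb y z).1)).1 h1
  have hlim : Tendsto (fun m : ℕ => 2 * Real.exp (-((p / 2) ^ 2 * m))) atTop (𝓝 (2 * 0)) := by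
    refine Tendsto.const_mul _ (Real.tendsto_exp_neg_atTop_nhds_zero.comp ?_)
    exact Tendsto.const_mul_atTop (by positivity) tendsto_natCast_atTop_atTop
  filter_upwards [hlim.eventually (gt_mem_nhds (by norm_num : (2 * 0 : ℝ) < 1))] with m hm
  have hsub : {ω | ¬ IsBalanced (p / 2) (sample Z m ω)} ⊆
      ⋃ y : Bool, {ω | p / 2 * m ≤ ∑ i, (∫ z, U y z ∂P - U y (sample Z m ω i))} := by
    intro ω hω
    simp only [Set.mem_ofPred_eq, IsBalanced, not_forall, not_le] at hω
    obtain ⟨y, hy⟩ := hω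
    refine Set.mem_iUnion.2 ⟨y, ?_⟩
    simp only [Set.mem_ofPred_eq, Finset.sum_sub_distrib, Finset.sum_const, Finset.card_univ,
      Fintype.card_fin, nsmul_eq_mul]
    have h1 : ∑ i, U y (sample Z m ω i) =
        ((Finset.univ.filter fun i => (sample Z m ω i).2 = y).card : ℝ) := by
      simp [hU]
    have h2 := mul_le_mul_of_nonneg_left (hUi y) (Nat.cast_nonneg (α := ℝ) m)
    rw [h1]
    linarith
  calc μ {ω | ¬ IsBalanced (p / 2) (sample Z m ω)}
      ≤ ∑ y : Bool, μ {ω | p / 2 * m ≤ ∑ i, (∫ z, U y z ∂P - U y (sample Z m ω i))} :=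
        (measure_mono hsub).trans (measure_iUnion_fintype_le _ _)
    _ ≤ ∑ _y : Bool, ENNReal.ofReal (Real.exp (-(2 * m * (p / 2) ^ 2 / (1 - 0) ^ 2))) :=
        Finset.sum_le_sum fun y _ => hoeffding_sample hZ_meas hZ_indep hZ_law (hUm y) (hUb y)
          (by positivity) m
    _ = ENNReal.ofReal ((2 * Real.exp (-((p / 2) ^ 2 * m))) * Real.exp (-((p / 2) ^ 2 * m))) := by
        rw [mul_assoc (2 : ℝ) (Real.exp _), ← Real.exp_add, Finset.sum_const, Finset.card_univ, Fintype.card_bool,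
          nsmul_eq_mul, ENNReal.ofReal_mul two_pos.le]
        congr 2
        · simp
        · congr 1; ring
    _ < _ := by
        rw [ENNReal.ofReal_lt_ofReal_iff (Real.exp_pos _)]
        exact mul_lt_of_lt_one_left (Real.exp_pos _) hm

end Hoeffding

/-! ### The bound for the estimator -/

section EstimatorBound

variable {X : Type*} [TopologicalSpace X] [CompactSpace X] [MeasurableSpace X]
  {H : Type*} [NormedAddCommGroup H] [InnerProductSpace ℝ H] [CompleteSpace H] [RKHS ℝ H X ℝ]
  {Ω : Type*} [MeasurableSpace Ω] {μ : Measure Ω} [IsProbabilityMeasure μ]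

/-- On a balanced sample the bound is deterministic: a minimizer exists, does at least as well as
`0`, and `exists_bound` applies with `B = K * lam m`. The exceptional event involves only the
sample, which makes the constants uniform over all choices of minimizer. -/
lemma IsUniversalKernel.exists_estimatorBound {K : ℝ} (hk : IsUniversalKernel H K)
    {P : Measure (X × Bool)} [IsProbabilityMeasure P] (hP : IsNonDeterministic P)
    {ℓ : ℝ → ℝ} (hℓ : IsBasicLoss ℓ) {lam : ℕ → ℝ} (hlam_pos : ∀ m, 0 < lam m)
    (hlam : Tendsto lam atTop atTop) {Z : ℕ → Ω → X × Bool}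
    (hZ_meas : ∀ i, Measurable (Z i)) (hZ_indep : iIndepFun Z μ)
    (hZ_law : ∀ i, μ.map (Z i) = P) :
    ∃ C : ℝ, 0 < C ∧ ∃ c : ℝ, 0 < c ∧ ∃ M : ℕ,
      ∀ (fhat : ℕ → Ω → H) (bhat rhohat : ℕ → Ω → ℝ), IsEstimator Z ℓ lam fhat bhat rhohat →
        EstimatorBound μ lam C c M fhat bhat rhohat := by
  obtain ⟨p, hp, c, hc, hbal⟩ := hP.exists_balanced hZ_meas hZ_indep hZ_law
  obtain ⟨D, hD0, hD⟩ := hℓ.exists_bound (X := X) hp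
  obtain ⟨M, hM⟩ := eventually_atTop.1
    ((hbal.and (eventually_ne_atTop 0)).and (hlam.eventually_ge_atTop 1))
  have hK := hk.K_pos
  refine ⟨2 * K + D, by positivity, c, hc, M, fun fhat bhat rhohat hest m hm => ?_⟩
  obtain ⟨⟨hμ, hm0⟩, hlam1⟩ := hM m hm
  refine (measure_mono (Set.compl_subset_compl.2 fun ω (hT : IsBalanced p _) => ?_)).trans_lt hμ
  have hmin := hest m ω (hℓ.exists_isMinimizer hk hp hm0 hT (hlam_pos m))
  have hf : ‖fhat m ω‖ ≤ lam m := le_of_sq_le_sq hmin.1 (hlam_pos m).le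
  have h1 := hmin.2 0 0 0 (by simpa using sq_nonneg (lam m))
  rw [empRisk_zero hm0] at h1
  obtain ⟨hb, hρ⟩ := hD hm0 hT (B := K * lam m) (fun x => (hk.abs_apply_le _ x).trans
    (mul_le_mul_of_nonneg_left hf hK.le)) h1 (mul_nonneg hK.le (hlam_pos m).le)
  -- The additive constant `D` is absorbed because `lam m ≥ 1` for `m ≥ M`.
  have h2 : 2 * (K * lam m) + D ≤ (2 * K + D) * lam m := by
    have := mul_le_mul_of_nonneg_left hlam1 hD0
    linarith
  exact ⟨hf, hb.trans h2, hρ.trans h2⟩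

end EstimatorBound

/-! ### Approximation of the optimal risk in the reproducing kernel Hilbert space -/

section Approximation

variable {X : Type*} [MeasurableSpace X] {ℓ : ℝ → ℝ} {P : Measure (X × Bool)}
  [IsProbabilityMeasure P]

/-- Labels have modulus one and all arguments of `ℓ` stay where it is `L`-Lipschitz, so the change
in risk is controlled by the L¹ distance under the marginal. -/
lemma IsBasicLoss.integral_lossFn_le (hℓ : IsBasicLoss ℓ) {f g : X → ℝ} (hf : Measurable f)
    (hg : Measurable g) {B ρ L : ℝ} (hfB : ∀ x, |f x| ≤ B) (hgB : ∀ x, |g x| ≤ B)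
    (hL : ∀ z z', |z| ≤ |ρ| + B → |z'| ≤ |ρ| + B → |ℓ z - ℓ z'| ≤ L * |z - z'|) :
    ∫ z, lossFn ℓ g ρ z ∂P ≤ ∫ z, lossFn ℓ f ρ z ∂P + L * ∫ x, |f x - g x| ∂P.fst := by
  have hd : Measurable fun x => |f x - g x| := (hf.sub hg).abs
  have hdi : Integrable (fun z : X × Bool => |f z.1 - g z.1|) P :=
    Integrable.of_mem_Icc 0 (B + B) (hd.comp measurable_fst).aemeasurable
      (Eventually.of_forall fun z => ⟨abs_nonneg _, (abs_sub _ _).trans (add_le_add (hfB _) (hgB _))⟩)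
  rw [Measure.fst, integral_map measurable_fst.aemeasurable hd.aestronglyMeasurable,
    ← integral_const_mul, ← integral_add (hℓ.integrable_lossFn P hf hfB ρ) (hdi.const_mul L)]
  refine integral_mono (hℓ.integrable_lossFn P hg hgB ρ)
    ((hℓ.integrable_lossFn P hf hfB ρ).add (hdi.const_mul L)) fun z => ?_
  have h1 := hL (ρ - label z.2 * g z.1) (ρ - label z.2 * f z.1)
    ((abs_sub_label_mul_le _ _ _).trans (by gcongr; exact hgB _))
    ((abs_sub_label_mul_le _ _ _).trans (by gcongr; exact hfB _))
  rw [show ρ - label z.2 * g z.1 - (ρ - label z.2 * f z.1) = label z.2 * (f z.1 - g z.1) by ring,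
    abs_mul, abs_label, one_mul] at h1
  have h2 := (abs_le.1 h1).2
  simp only [lossFn]
  linarith

/-- Truncation of a decision function does not increase the risk by much. -/
lemma IsBasicLoss.tendsto_integral_truncation (hℓ : IsBasicLoss ℓ) {f : X → ℝ} (hf : Measurable f)
    {ρ : ℝ} (hi : Integrable (lossFn ℓ f ρ) P) :
    Tendsto (fun n : ℕ => ∫ z, lossFn ℓ (fun x => max (-(n : ℝ)) (min (f x) n)) ρ z ∂P) atTop
      (𝓝 (∫ z, lossFn ℓ f ρ z ∂P)) := by
  -- The truncated value lies between `0` and `f`, so monotonicity bounds its loss by `ℓ ρ` plus the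
  -- original loss; `4 * |ρ|` pays for the terms `-2 * ρ`.
  refine tendsto_integral_of_dominated_convergence
    (fun z => 4 * |ρ| + ℓ ρ + lossFn ℓ f ρ z) (fun n => ?_)
    ((integrable_const _).add hi) (fun n => Eventually.of_forall fun z => ?_)
    (Eventually.of_forall fun z => ?_)
  · exact (hℓ.measurable_lossFn (measurable_const.max (hf.min measurable_const))
      ρ).aestronglyMeasurable
  · set t := max (-(n : ℝ)) (min (f z.1) n) with ht
    have hn : (0 : ℝ) ≤ n := Nat.cast_nonneg n
    have h0 := hℓ.nonneg ρ
    have h1 := hℓ.nonneg (ρ - label z.2 * f z.1)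
    have h2 := hℓ.nonneg (ρ - label z.2 * t)
    have h3 : ℓ (ρ - label z.2 * t) ≤ ℓ ρ + ℓ (ρ - label z.2 * f z.1) := by
      have hmax : ρ - label z.2 * t ≤ max ρ (ρ - label z.2 * f z.1) := by
        rw [le_max_iff]
        cases z.2 <;> simp only [label] <;> norm_num <;>
          rcases le_total 0 (f z.1) with h | h
        · right; rw [ht]; exact max_le (by linarith) (min_le_left _ _)
        · left; rw [ht]; exact max_le (by linarith) ((min_le_left _ _).trans h)
        · left; rw [ht]; exact le_max_of_le_right (le_min h hn)
        · right
          have h6 : f z.1 ≤ t := le_max_of_le_right (le_min le_rfl (h.trans hn))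
          linarith
      rcases le_max_iff.1 hmax with h | h
      · linarith [hℓ.monotone h]
      · linarith [hℓ.monotone h]
    simp only [lossFn, Real.norm_eq_abs]
    have h4 := neg_abs_le ρ
    have h5 := le_abs_self ρ
    rw [abs_le]
    constructor <;> linarith
  · obtain ⟨N, hN⟩ := exists_nat_ge |f z.1|
    refine tendsto_const_nhds.congr' ?_
    filter_upwards [eventually_ge_atTop N] with n hn
    have h1 : |f z.1| ≤ n := hN.trans (by exact_mod_cast hn)
    have h2 := abs_le.1 h1
    simp only [lossFn]
    rw [min_eq_left h2.2, max_eq_right h2.1]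

end Approximation

section Approximation

variable {X : Type*} [MetricSpace X] [CompactSpace X] [MeasurableSpace X] [BorelSpace X]
  {H : Type*} [NormedAddCommGroup H] [InnerProductSpace ℝ H] [CompleteSpace H] [RKHS ℝ H X ℝ]
  {ℓ : ℝ → ℝ} {P : Measure (X × Bool)} [IsProbabilityMeasure P]

/-- Bounded decision functions can be replaced by elements of a universal RKHS. -/
lemma IsUniversalKernel.exists_integral_lossFn_le {K : ℝ} (hk : IsUniversalKernel H K)
    (hℓ : IsBasicLoss ℓ) {f : X → ℝ} (hf : Measurable f) {B : ℝ} (hB : ∀ x, |f x| ≤ B)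
    (ρ : ℝ) {ε : ℝ} (hε : 0 < ε) :
    ∃ h : H, ∫ z, lossFn ℓ h ρ z ∂P ≤ ∫ z, lossFn ℓ f ρ z ∂P + ε := by
  have hne : Nonempty X := nonempty_of_isProbabilityMeasure P.fst
  obtain ⟨x₀⟩ := hne
  have hB0 : 0 ≤ B := (abs_nonneg _).trans (hB x₀)
  -- The approximant will be bounded by `B + 1` since `δ ≤ 1`. Its L¹ error is at most `2δ`, and `L
  -- + 1` keeps the denominator of `δ` positive.
  obtain ⟨L, hL0, hL⟩ := hℓ.exists_lipschitz (|ρ| + (B + 1))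
  set δ := min 1 (ε / (2 * (L + 1))) with hδ
  have hδ0 : 0 < δ := lt_min one_pos (by positivity)
  have hfi : Integrable f P.fst := Integrable.of_mem_Icc (-B) B hf.aemeasurable
    (Eventually.of_forall fun x => abs_le.1 (hB x))
  obtain ⟨g₀, hg₀, hg₀i⟩ := hfi.exists_boundedContinuous_integral_sub_le hδ0
  -- Clamping to `[-B, B]` is a contraction that fixes the values of `f`, so it bounds `g₀` without
  -- increasing the error.
  set g : C(X, ℝ) := ⟨fun x => max (-B) (min (g₀ x) B), by fun_prop⟩ with hg
  obtain ⟨h', ⟨h, hh⟩, hdist⟩ := Metric.dense_iff.1 hk.universal g δ hδ0 |>.imp fun _ h => h.symm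
  have hgh : ∀ x, |g x - h x| ≤ δ := fun x => by
    rw [← hh, ← Real.dist_eq, dist_comm]
    exact (ContinuousMap.dist_apply_le_dist x).trans (Metric.mem_ball.1 hdist).le
  have hgB : ∀ x, |g x| ≤ B := fun x =>
    abs_le.2 ⟨le_max_left _ _, max_le (by linarith) (min_le_right _ _)⟩
  have hfg : ∀ x, |f x - g x| ≤ |f x - g₀ x| := fun x => by
    have h1 := abs_le.1 (hB x)
    have h2 : f x = max (-B) (min (f x) B) := by rw [min_eq_left h1.2, max_eq_right h1.1]
    calc |f x - g x| = |max (min (f x) B) (-B) - max (min (g₀ x) B) (-B)| := by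
          rw [max_comm _ (-B), max_comm _ (-B), ← h2]; rfl
      _ ≤ |min (f x) B - min (g₀ x) B| := abs_max_sub_max_le_abs _ _ _
      _ ≤ _ := by
        refine (abs_min_sub_min_le_max _ _ _ _).trans ?_
        simp
  have hhB : ∀ x, |h x| ≤ B + 1 := fun x => by
    have h1 := abs_le.1 (hgh x)
    have h2 := abs_le.1 (hgB x)
    have h3 : δ ≤ 1 := min_le_left _ _
    exact abs_le.2 ⟨by linarith, by linarith⟩
  have hhm : Measurable (h : X → ℝ) := (hk.continuous_coe h).measurable
  refine ⟨h, (hℓ.integral_lossFn_le hf hhm (fun x => (hB x).trans (by linarith)) hhB hL).trans ?_⟩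
  have h1 : ∫ x, |f x - h x| ∂P.fst ≤ δ + δ := by
    calc ∫ x, |f x - h x| ∂P.fst ≤ ∫ x, (‖f x - g₀ x‖ + δ) ∂P.fst := by
          refine integral_mono_of_nonneg (Eventually.of_forall fun x => abs_nonneg _)
            ((hfi.sub hg₀i).norm.add (integrable_const _)) (Eventually.of_forall fun x => ?_)
          exact (abs_sub_le _ (g x) _).trans (add_le_add (hfg x) (hgh x))
      _ = ∫ x, ‖f x - g₀ x‖ ∂P.fst + δ := by
          rw [integral_add (f := fun x => ‖f x - g₀ x‖) (hfi.sub hg₀i).norm (integrable_const _)]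
          simp
      _ ≤ _ := by gcongr
  have h2 : δ ≤ ε / (2 * (L + 1)) := min_le_right _ _
  have h3 : L * ∫ x, |f x - h x| ∂P.fst ≤ ε := by
    calc L * ∫ x, |f x - h x| ∂P.fst ≤ (L + 1) * (δ + δ) :=
          mul_le_mul (by linarith) h1 (integral_nonneg fun x => abs_nonneg _) (by positivity)
      _ ≤ (L + 1) * (ε / (2 * (L + 1)) + ε / (2 * (L + 1))) := by gcongr
      _ = ε := by field_simp; ring
  linarith

/-- Three errors of `ε / 3`: a nearly optimal measurable function, its truncation, and approximation
of the truncation in `H`. Truncation comes first since `ℓ` is only locally Lipschitz. -/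
lemma IsUniversalKernel.exists_le_optRisk_add {K : ℝ} (hk : IsUniversalKernel H K)
    (hℓ : IsBasicLoss ℓ) (hP : IsNonDeterministic P) {ε : ℝ} (hε : 0 < ε) :
    ∃ (h : H) (ρ : ℝ), ∫ z, lossFn ℓ h ρ z ∂P ≤ (optRisk P ℓ).toReal + ε := by
  have hr := EReal.coe_toReal (hℓ.optRisk_ne_top (P := P)) (hℓ.optRisk_ne_bot hP)
  set r := (optRisk P ℓ).toReal
  have hlt : optRisk P ℓ < ((r + ε / 3 : ℝ) : EReal) := by
    rw [← hr, EReal.coe_lt_coe_iff]; linarith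
  simp only [optRisk, iInf_lt_iff] at hlt
  obtain ⟨f, hf, ρ, hlt⟩ := hlt
  have hi : Integrable (lossFn ℓ f ρ) P := by
    have hfin : (∫⁻ z, ENNReal.ofReal (ℓ (ρ - label z.2 * f z.1)) ∂P) ≠ ⊤ := by
      intro htop
      rw [risk, htop, EReal.coe_ennreal_top, EReal.coe_add_top] at hlt
      exact not_top_lt hlt
    refine (integrable_const _).add ⟨(hℓ.measurable_loss hf ρ).aestronglyMeasurable, ?_⟩
    rw [hasFiniteIntegral_iff_ofReal (Eventually.of_forall fun z => hℓ.nonneg _)]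
    exact hfin.lt_top
  rw [hℓ.risk_eq P hi, EReal.coe_lt_coe_iff] at hlt
  obtain ⟨n, hn⟩ := ((hℓ.tendsto_integral_truncation hf hi).eventually
    (gt_mem_nhds (lt_add_of_pos_right _ (by positivity : 0 < ε / 3)))).exists
  obtain ⟨h, hh⟩ := hk.exists_integral_lossFn_le (P := P) hℓ
    (measurable_const.max (hf.min measurable_const)) (B := n)
    (fun x => abs_le.2 ⟨le_max_left _ _, max_le (by linarith [Nat.cast_nonneg (α := ℝ) n])
      (min_le_right _ _)⟩) ρ (by positivity : 0 < ε / 3)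
  exact ⟨h, ρ, by linarith⟩

end Approximation

/-! ### Uniform deviations -/

/-- A finite grid in `[-A, A]` of mesh `r`. -/
lemma exists_grid {A r : ℝ} (hr : 0 < r) (hA : r ≤ 2 * A) :
    ∃ G : Finset ℝ, (G.card : ℝ) ≤ 2 * (2 * A / r) ∧ (∀ b ∈ G, |b| ≤ A) ∧
      ∀ b, |b| ≤ A → ∃ b' ∈ G, |b - b'| ≤ r := by
  have hA0 : 0 ≤ 2 * A / r := div_nonneg (hr.le.trans hA) hr.le
  refine ⟨(Finset.range (⌊2 * A / r⌋₊ + 1)).image fun j : ℕ => -A + j * r, ?_, ?_, ?_⟩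
  · have h1 : ((Finset.range (⌊2 * A / r⌋₊ + 1)).image fun j : ℕ => -A + j * r).card ≤
        ⌊2 * A / r⌋₊ + 1 := Finset.card_image_le.trans (by simp)
    have h2 : (((Finset.range (⌊2 * A / r⌋₊ + 1)).image fun j : ℕ => -A + j * r).card : ℝ) ≤
        ⌊2 * A / r⌋₊ + 1 := by exact_mod_cast h1
    have h3 := Nat.floor_le hA0
    -- The condition `r ≤ 2 * A` lets the factor `2` absorb the extra grid point.
    have h4 : 1 ≤ 2 * A / r := (one_le_div hr).2 hA
    linarith
  · intro b hb
    obtain ⟨j, hj, rfl⟩ := Finset.mem_image.1 hb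
    have h1 : (j : ℝ) ≤ 2 * A / r :=
      (Nat.le_floor_iff hA0).1 (Nat.lt_succ_iff.1 (Finset.mem_range.1 hj))
    rw [le_div_iff₀ hr] at h1
    have h2 : 0 ≤ (j : ℝ) * r := by positivity
    exact abs_le.2 ⟨by linarith, by linarith⟩
  · intro b hb
    have hb' := abs_le.1 hb
    have h0 : 0 ≤ (b + A) / r := div_nonneg (by linarith) hr.le
    refine ⟨-A + ⌊(b + A) / r⌋₊ * r, Finset.mem_image.2 ⟨_, Finset.mem_range.2
      (Nat.lt_succ_iff.2 (Nat.floor_le_floor ?_)), rfl⟩, ?_⟩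
    · gcongr; linarith
    · have h1 := Nat.floor_le h0
      have h2 := (Nat.lt_floor_add_one ((b + A) / r)).le
      rw [le_div_iff₀ hr] at h1
      rw [div_le_iff₀ hr] at h2
      exact abs_le.2 ⟨by linarith, by linarith⟩

section LossDifference

variable {X : Type*} {ℓ : ℝ → ℝ}

/-- The linear term moves by at most `2r` and the argument of `ℓ` by at most `3r`. The distance `2r`
between the functions allows `r` for the element of `H` and `r` for the offset. -/
lemma abs_lossFn_sub_le {f g : X → ℝ} {ρ σ B r κ : ℝ} (hκ : 0 ≤ κ)
    (hL : ∀ z z', |z| ≤ B → |z'| ≤ B → |ℓ z - ℓ z'| ≤ κ * |z - z'|)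
    (hf : ∀ x, |ρ| + |f x| ≤ B) (hg : ∀ x, |σ| + |g x| ≤ B)
    (hρ : |ρ - σ| ≤ r) (hfg : ∀ x, |f x - g x| ≤ 2 * r) (z : X × Bool) :
    |lossFn ℓ f ρ z - lossFn ℓ g σ z| ≤ 3 * r * (2 + κ) := by
  have h1 := hL (ρ - label z.2 * f z.1) (σ - label z.2 * g z.1)
    ((abs_sub_label_mul_le _ _ _).trans (hf _)) ((abs_sub_label_mul_le _ _ _).trans (hg _))
  have h2 : |ρ - label z.2 * f z.1 - (σ - label z.2 * g z.1)| ≤ 3 * r := by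
    rw [show ρ - label z.2 * f z.1 - (σ - label z.2 * g z.1) =
      (ρ - σ) - label z.2 * (f z.1 - g z.1) by ring]
    have := (abs_sub_label_mul_le (ρ - σ) (f z.1 - g z.1) z.2).trans (add_le_add hρ (hfg _))
    linarith
  have h3 := abs_le.1 (h1.trans (mul_le_mul_of_nonneg_left h2 hκ))
  have h4 := abs_le.1 hρ
  have h5 : 0 ≤ r := (abs_nonneg _).trans hρ
  simp only [lossFn]
  exact abs_le.2 ⟨by linarith, by linarith⟩

end LossDifference

section Deviation

lemma IsLipschitzConst.nonneg {ℓ : ℝ → ℝ} {K C : ℝ} {lam κ : ℕ → ℝ}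
    (h : IsLipschitzConst ℓ K C lam κ) {m : ℕ} (hpos : 0 < (K + 2 * C) * lam m) : 0 ≤ κ m := by
  have h1 := h m ((K + 2 * C) * lam m) 0 (by rw [abs_of_pos hpos]) (by simpa using hpos.le)
  rw [sub_zero, abs_of_pos hpos] at h1
  exact nonneg_of_mul_nonneg_left ((abs_nonneg _).trans h1) hpos

variable {X : Type*} [MetricSpace X] [CompactSpace X] [MeasurableSpace X] [BorelSpace X]
  {H : Type*} [NormedAddCommGroup H] [InnerProductSpace ℝ H] [CompleteSpace H] [RKHS ℝ H X ℝ]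
  {ℓ : ℝ → ℝ} {P : Measure (X × Bool)} [IsProbabilityMeasure P]
  {Ω : Type*} [MeasurableSpace Ω] {μ : Measure Ω} [IsProbabilityMeasure μ]
  {Z : ℕ → Ω → X × Bool}

/-- The probability that the empirical risk underestimates the risk by more than `ε`, somewhere
on the set of admissible parameters. -/
lemma IsUniversalKernel.measure_deviation_le {K : ℝ} (hk : IsUniversalKernel H K)
    (hℓ : IsBasicLoss ℓ) (hZ_meas : ∀ i, Measurable (Z i)) (hZ_indep : iIndepFun Z μ)
    (hZ_law : ∀ i, μ.map (Z i) = P) {lam : ℕ → ℝ} {C : ℝ} (hC : 0 < C) {κ : ℕ → ℝ}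
    (hκ : IsLipschitzConst ℓ K C lam κ) {ε : ℝ} (hε : 0 < ε) {m : ℕ} (hm : m ≠ 0)
    (hlam : 0 < lam m) (hq : 1 ≤ 18 * C * lam m * (2 + κ m) / ε) :
    μ {ω | ∃ (f : H) (b ρ : ℝ), ‖f‖ ≤ lam m ∧ |b| ≤ C * lam m ∧ |ρ| ≤ C * lam m ∧
        empRisk (sample Z m ω) ℓ (fun x => f x + b) ρ + ε <
          ∫ z, lossFn ℓ (fun x => f x + b) ρ z ∂P} ≤
      2 * uniformBound H ℓ K C lam κ ε m := by
  have hK := hk.K_pos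
  have hm' : (0 : ℝ) < m := by exact_mod_cast Nat.pos_of_ne_zero hm
  have hκ0 : 0 ≤ κ m := hκ.nonneg (by positivity)
  set A := C * lam m with hA
  -- Chosen so that `3 * r * (2 + κ m) = ε / 3`: moving to a net point costs `ε / 3` in the risk and
  -- `ε / 3` in the empirical risk, leaving a deviation of `ε / 3` there.
  set r := ε / (9 * (2 + κ m)) with hr
  have hr0 : 0 < r := by positivity
  set q := 18 * C * lam m * (2 + κ m) / ε with hqdef
  have hqr : 2 * A / r = q := by rw [hr, hqdef, hA]; field_simp; ring
  set e := ENNReal.ofReal (Real.exp (-(2 * m * ε ^ 2 / (9 * lossRange ℓ K C lam m ^ 2)))) with he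
  have he0 : e ≠ 0 := by simp [he, Real.exp_pos]
  have hq0 : ENNReal.ofReal (q ^ 2) ≠ 0 := by
    have : 0 < q := one_pos.trans_le hq
    exact (ENNReal.ofReal_pos.2 (by positivity)).ne'
  have hub : uniformBound H ℓ K C lam κ ε m =
      2 * (Metric.coveringNumber r.toNNReal (supBall (X := X) H (lam m)) : ℝ≥0∞) *
        ENNReal.ofReal (q ^ 2) * e := rfl
  rw [hub]
  -- An infinite covering number makes the right-hand side infinite, as the other factors are
  -- nonzero.
  by_cases hN : Metric.coveringNumber r.toNNReal (supBall (X := X) H (lam m)) = ⊤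
  · simp [hN, ENNReal.top_mul, hq0, he0]
  obtain ⟨S, hSsub, hSfin, hcover, hScard⟩ := Metric.exists_set_encard_eq_coveringNumber hN
  obtain ⟨G, hGcard, hGA, hG⟩ := exists_grid hr0 (A := A) (by
    rwa [← hqr, one_le_div hr0] at hq)
  rw [hqr] at hGcard
  have hbound : ∀ (f : H) (b : ℝ), ‖f‖ ≤ lam m → |b| ≤ A → ∀ x,
      |f x + b| ≤ (K + C) * lam m := fun f b hf hb x => by
    have h1 := (hk.abs_apply_le f x).trans (mul_le_mul_of_nonneg_left hf hK.le)
    have h2 := abs_add_le (f x) b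
    rw [hA] at hb
    linarith
  set E : C(X, ℝ) × ℝ × ℝ → Set Ω := fun i => {ω | ε / 3 * m ≤
    ∑ j, (∫ z, lossFn ℓ (fun x => i.1 x + i.2.1) i.2.2 z ∂P -
      lossFn ℓ (fun x => i.1 x + i.2.1) i.2.2 (sample Z m ω j))} with hE
  have hEμ : ∀ i ∈ hSfin.toFinset ×ˢ (G ×ˢ G), μ (E i) ≤ e := by
    rintro ⟨g, b, ρ⟩ hi
    simp only [Finset.mem_product, Set.Finite.mem_toFinset] at hi
    obtain ⟨hg, hb, hρ⟩ := hi
    obtain ⟨f, hf, hgf⟩ := hSsub hg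
    have h1 := hoeffding_sample hZ_meas hZ_indep hZ_law
      (hℓ.measurable_lossFn (f := fun x => g x + b) (by fun_prop) ρ)
      (fun z => hℓ.lossFn_mem_Icc (hGA ρ hρ)
        (fun x => by rw [hgf]; exact hbound f b hf (hGA b hb) x) z)
      (t := ε / 3) (by positivity) m
    -- The loss at a net point ranges over an interval of length `4A + ℓ(A + (K + C) * lam m)`,
    -- which is exactly `lossRange`.
    refine h1.trans (le_of_eq ?_)
    rw [he, lossRange, hA, show C * lam m + (K + C) * lam m = (K + 2 * C) * lam m by ring,
      show 2 * (C * lam m) + ℓ ((K + 2 * C) * lam m) - -2 * (C * lam m) =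
        4 * C * lam m + ℓ ((K + 2 * C) * lam m) by ring, div_pow, mul_div_assoc', div_div]
    norm_num
  have hsub : {ω | ∃ (f : H) (b ρ : ℝ), ‖f‖ ≤ lam m ∧ |b| ≤ A ∧ |ρ| ≤ A ∧
        empRisk (sample Z m ω) ℓ (fun x => f x + b) ρ + ε <
          ∫ z, lossFn ℓ (fun x => f x + b) ρ z ∂P} ⊆
      ⋃ i ∈ hSfin.toFinset ×ˢ (G ×ˢ G), E i := by
    rintro ω ⟨f, b, ρ, hf, hb, hρ, hdev⟩
    obtain ⟨g, hgS, hfg⟩ := hcover (x := ⟨f, hk.continuous_coe f⟩) ⟨f, hf, rfl⟩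
    obtain ⟨b', hb'G, hb'⟩ := hG b hb
    obtain ⟨ρ', hρ'G, hρ'⟩ := hG ρ hρ
    obtain ⟨f', hf', hgf'⟩ := hSsub hgS
    have hfg' : ∀ x, |f x - g x| ≤ r := fun x => by
      have h1 : edist (⟨f, hk.continuous_coe f⟩ : C(X, ℝ)) g ≤ (r.toNNReal : ℝ≥0∞) := hfg
      rw [edist_nndist, ENNReal.coe_le_coe, ← NNReal.coe_le_coe, coe_nndist,
        Real.coe_toNNReal _ hr0.le] at h1
      exact (ContinuousMap.dist_apply_le_dist (f := ⟨f, hk.continuous_coe f⟩) x).trans h1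
    have hfB := hbound f b hf hb
    have hgB : ∀ x, |g x + b'| ≤ (K + C) * lam m := fun x => by
      rw [hgf']; exact hbound f' b' hf' (hGA b' hb'G) x
    have hfm : Measurable fun x => f x + b := ((hk.continuous_coe f).add_const b).measurable
    have hgm : Measurable fun x => g x + b' := by fun_prop
    have hdiff : ∀ z, |lossFn ℓ (fun x => f x + b) ρ z -
        lossFn ℓ (fun x => g x + b') ρ' z| ≤ ε / 3 := fun z => by
      have hρA := hGA ρ' hρ'G
      refine (abs_lossFn_sub_le (r := r) hκ0 (hκ m) (fun x => ?_) (fun x => ?_) hρ'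
        (fun x => ?_) z).trans (le_of_eq ?_)
      · have := hfB x
        rw [hA] at hρ
        linarith
      · have := hgB x
        rw [hA] at hρA
        linarith
      · rw [show f x + b - (g x + b') = (f x - g x) + (b - b') by ring]
        exact (abs_add_le _ _).trans (by linarith [hfg' x])
      · rw [hr]; field_simp; norm_num
    refine Set.mem_iUnion₂.2 ⟨(g, b', ρ'), ?_, ?_⟩
    · simp [hgS, hb'G, hρ'G]
    have hint : ∫ z, lossFn ℓ (fun x => f x + b) ρ z ∂P ≤
        ∫ z, lossFn ℓ (fun x => g x + b') ρ' z ∂P + ε / 3 := by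
      have h1 := integral_mono (hℓ.integrable_lossFn P hfm hfB ρ)
        ((hℓ.integrable_lossFn P hgm hgB ρ').add (integrable_const (ε / 3)))
        (fun z => by
          have := (abs_le.1 (hdiff z)).2
          simp only [Pi.add_apply]
          linarith)
      refine h1.trans (le_of_eq ?_)
      simp only [Pi.add_apply]
      rw [integral_add (hℓ.integrable_lossFn P hgm hgB ρ') (integrable_const _)]
      simp
    rw [empRisk_eq hm] at hdev
    have hsum : ∑ j, lossFn ℓ (fun x => g x + b') ρ' (sample Z m ω j) ≤
        ∑ j, lossFn ℓ (fun x => f x + b) ρ (sample Z m ω j) + m * (ε / 3) := by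
      have h1 : ∑ j, lossFn ℓ (fun x => g x + b') ρ' (sample Z m ω j) ≤
          ∑ j, (lossFn ℓ (fun x => f x + b) ρ (sample Z m ω j) + ε / 3) :=
        Finset.sum_le_sum fun j _ => by
          have := (abs_le.1 (hdiff (sample Z m ω j))).1
          linarith
      simpa [Finset.sum_add_distrib] using h1
    have hmul := mul_lt_mul_of_pos_left (hdev.trans_le hint) hm'
    rw [mul_add, ← mul_assoc, mul_one_div_cancel hm'.ne', one_mul, mul_add] at hmul
    simp only [hE, Set.mem_ofPred_eq, Finset.sum_sub_distrib, Finset.sum_const, Finset.card_univ,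
      Fintype.card_fin, nsmul_eq_mul]
    linarith
  have hcardS : ((hSfin.toFinset.card : ℕ) : ℝ≥0∞) =
      (Metric.coveringNumber r.toNNReal (supBall (X := X) H (lam m)) : ℝ≥0∞) := by
    rw [← hScard, hSfin.encard_eq_coe_toFinset_card]
    simp
  have hcardG : (G.card : ℝ≥0∞) ≤ ENNReal.ofReal (2 * q) := by
    rw [← ENNReal.ofReal_natCast]
    exact ENNReal.ofReal_le_ofReal hGcard
  calc _ ≤ ∑ i ∈ hSfin.toFinset ×ˢ (G ×ˢ G), μ (E i) :=
        (measure_mono hsub).trans (measure_biUnion_finset_le _ _)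
    _ ≤ ∑ _i ∈ hSfin.toFinset ×ˢ (G ×ˢ G), e := Finset.sum_le_sum hEμ
    _ = (hSfin.toFinset.card : ℝ≥0∞) * (G.card * G.card) * e := by
        simp [Finset.card_product]
    _ ≤ (Metric.coveringNumber r.toNNReal (supBall (X := X) H (lam m)) : ℝ≥0∞) *
          (ENNReal.ofReal (2 * q) * ENNReal.ofReal (2 * q)) * e := by
        rw [hcardS]; gcongr
    -- The two grids contribute `(2q)² = 4q²`, twice the `2q²` of `uniformBound`; hence the extra
    -- factor `2` in the statement.
    _ = _ := by
        rw [ENNReal.ofReal_mul two_pos.le, ENNReal.ofReal_pow (by positivity)]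
        simp only [ENNReal.ofReal_ofNat]
        ring

end Deviation

/-! ### Convergence of the risk -/

section Convergence

variable {X : Type*} [MeasurableSpace X] {ℓ : ℝ → ℝ} {P : Measure (X × Bool)}
  {Ω : Type*} [MeasurableSpace Ω] {μ : Measure Ω} [IsProbabilityMeasure μ]
  {Z : ℕ → Ω → X × Bool}

/-- The empirical risk of a fixed bounded decision function rarely exceeds its risk by much. -/
lemma IsBasicLoss.tendsto_measure_empRisk (hℓ : IsBasicLoss ℓ)
    (hZ_meas : ∀ i, Measurable (Z i)) (hZ_indep : iIndepFun Z μ)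
    (hZ_law : ∀ i, μ.map (Z i) = P) {f : X → ℝ} (hf : Measurable f) {B : ℝ}
    (hB : ∀ x, |f x| ≤ B) (ρ : ℝ) {ε : ℝ} (hε : 0 < ε) :
    Tendsto (fun m => μ {ω | ∫ z, lossFn ℓ f ρ z ∂P + ε < empRisk (sample Z m ω) ℓ f ρ})
      atTop (𝓝 0) := by
  obtain ⟨D, hD0, hD⟩ : ∃ D : ℝ, 0 < D ∧ ∀ z, lossFn ℓ f ρ z ∈ Set.Icc (-D) D := by
    -- The summand `1` forces `D > 0`, so that the exponential rate is not a division by zero.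
    refine ⟨2 * |ρ| + ℓ (|ρ| + B) + 1, by have := hℓ.nonneg (|ρ| + B); positivity, fun z => ?_⟩
    have h1 := hℓ.lossFn_mem_Icc (le_refl |ρ|) hB z
    have h2 := hℓ.nonneg (|ρ| + B)
    exact ⟨by linarith [h1.1], by linarith [h1.2]⟩
  have hlim : Tendsto (fun m : ℕ =>
      ENNReal.ofReal (Real.exp (-(2 * m * ε ^ 2 / (D - -D) ^ 2)))) atTop (𝓝 0) := by
    rw [← ENNReal.ofReal_zero]
    refine ENNReal.tendsto_ofReal (Real.tendsto_exp_neg_atTop_nhds_zero.comp ?_)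
    have h1 : Tendsto (fun m : ℕ => (m : ℝ) * (2 * ε ^ 2 / (D - -D) ^ 2)) atTop atTop :=
      tendsto_natCast_atTop_atTop.atTop_mul_const (by
        have : 0 < D - -D := by linarith
        positivity)
    exact h1.congr fun m => by ring
  refine tendsto_of_tendsto_of_tendsto_of_le_of_le' tendsto_const_nhds hlim
    (Eventually.of_forall fun m => zero_le) ?_
  filter_upwards [eventually_ne_atTop 0] with m hm
  have hm' : (0 : ℝ) < m := by exact_mod_cast Nat.pos_of_ne_zero hm
  refine (measure_mono fun ω hω => ?_).trans (hoeffding_sample hZ_meas hZ_indep hZ_law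
    (U := fun z => -lossFn ℓ f ρ z) (hℓ.measurable_lossFn hf ρ).neg
    (fun z => ⟨neg_le_neg (hD z).2, neg_le.1 (hD z).1⟩) hε.le m)
  simp only [Set.mem_ofPred_eq, empRisk_eq hm] at hω
  have h1 := mul_lt_mul_of_pos_left hω hm'
  rw [← mul_assoc, mul_one_div_cancel hm'.ne', one_mul, mul_add] at h1
  simp only [Set.mem_ofPred_eq, integral_neg, Finset.sum_sub_distrib, Finset.sum_neg_distrib,
    Finset.sum_const, Finset.card_univ, Fintype.card_fin, nsmul_eq_mul]
  linarith

variable [MetricSpace X] [CompactSpace X] [BorelSpace X] [IsProbabilityMeasure P]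
  {H : Type*} [NormedAddCommGroup H] [InnerProductSpace ℝ H] [CompleteSpace H] [RKHS ℝ H X ℝ]

/-- The risk of the estimator converges in probability to the optimal risk. -/
lemma IsUniversalKernel.tendstoInMeasure_risk {K : ℝ} (hk : IsUniversalKernel H K)
    (hP : IsNonDeterministic P) (hℓ : IsBasicLoss ℓ) {lam : ℕ → ℝ} (hlam_pos : ∀ m, 0 < lam m)
    (hlam : Tendsto lam atTop atTop) (hZ_meas : ∀ i, Measurable (Z i))
    (hZ_indep : iIndepFun Z μ) (hZ_law : ∀ i, μ.map (Z i) = P)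
    {fhat : ℕ → Ω → H} {bhat rhohat : ℕ → Ω → ℝ} (hest : IsEstimator Z ℓ lam fhat bhat rhohat)
    {C c : ℝ} {M : ℕ} (hC : 0 < C) (hc : 0 < c)
    (hbound : EstimatorBound μ lam C c M fhat bhat rhohat) {κ : ℕ → ℝ}
    (hκ : IsLipschitzConst ℓ K C lam κ)
    (hunif : ∀ ε : ℝ, 0 < ε → Tendsto (uniformBound H ℓ K C lam κ ε) atTop (𝓝 0)) :
    TendstoInMeasure μ
      (fun m ω => (risk P ℓ (fun x => fhat m ω x + bhat m ω) (rhohat m ω)).toReal)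
      atTop (fun _ => (optRisk P ℓ).toReal) := by
  rw [tendstoInMeasure_iff_dist]
  intro ε hε
  have hK := hk.K_pos
  have hexp : ∀ a : ℝ, 0 < a →
      Tendsto (fun m : ℕ => ENNReal.ofReal (Real.exp (-(a * m)))) atTop (𝓝 0) := fun a ha => by
    rw [← ENNReal.ofReal_zero]
    exact ENNReal.tendsto_ofReal (Real.tendsto_exp_neg_atTop_nhds_zero.comp
      (tendsto_natCast_atTop_atTop.const_mul_atTop ha))
  obtain ⟨p, hp, a, ha, hbal⟩ := hP.exists_balanced hZ_meas hZ_indep hZ_law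
  obtain ⟨h, σ, hopt⟩ := hk.exists_le_optRisk_add hℓ hP (by positivity : 0 < ε / 4)
  have hlln := hℓ.tendsto_measure_empRisk hZ_meas hZ_indep hZ_law
    (hk.continuous_coe h).measurable (hk.abs_apply_le h) σ (by positivity : 0 < ε / 4)
  have hlim := (((hexp c hc).add (hexp a ha)).add
    ((ENNReal.Tendsto.const_mul (a := 2) (hunif (ε / 4) (by positivity))
      (Or.inr ENNReal.ofNat_ne_top)))).add hlln
  simp only [mul_zero, add_zero] at hlim
  refine tendsto_of_tendsto_of_tendsto_of_le_of_le' tendsto_const_nhds hlim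
    (Eventually.of_forall fun m => zero_le) ?_
  -- Eventually `h` is admissible, and `lam m` is large enough for the grid condition `hq`.
  filter_upwards [hbal, eventually_ge_atTop M, eventually_ne_atTop 0,
    hlam.eventually_ge_atTop ‖h‖, hlam.eventually_ge_atTop (ε / 4 / (36 * C))]
    with m hbal hmM hm hhlam hlarge
  have hκ0 : 0 ≤ κ m := hκ.nonneg (mul_pos (by positivity) (hlam_pos m))
  have hq : 1 ≤ 18 * C * lam m * (2 + κ m) / (ε / 4) := by
    rw [one_le_div (by positivity)]
    rw [div_le_iff₀ (by positivity)] at hlarge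
    have := mul_nonneg (mul_pos (mul_pos (by norm_num : (0 : ℝ) < 18) hC) (hlam_pos m)).le hκ0
    linarith
  have hdev := hk.measure_deviation_le hℓ hZ_meas hZ_indep hZ_law hC hκ
    (by positivity : 0 < ε / 4) hm (hlam_pos m) hq
  refine (measure_mono ?_).trans ((measure_union_le _ _).trans (add_le_add
    ((measure_union_le _ _).trans (add_le_add ((measure_union_le _ _).trans
      (add_le_add (hbound m hmM).le hbal.le)) hdev)) le_rfl))
  intro ω hω
  by_contra hgood
  simp only [Set.mem_union, not_or, Set.mem_ofPred_eq, not_not, not_lt] at hgood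
  obtain ⟨⟨⟨⟨hf, hb, hρ⟩, hT⟩, hunifω⟩, hllnω⟩ := hgood
  have hmin := hest m ω (hℓ.exists_isMinimizer hk hp hm hT (hlam_pos m))
  -- Off the four bad events: risk of the estimator ≤ its empirical risk + `ε / 4` ≤ empirical risk
  -- of `(h, σ)` + `ε / 4` ≤ risk of `(h, σ)` + `ε / 2` ≤ optimal risk + `3ε / 4`. The reverse
  -- inequality is the definition of the infimum.
  have h1 := not_lt.1 fun hlt => hunifω ⟨_, _, _, hf, hb, hρ, hlt⟩
  have h2 := hmin.2 h 0 σ (pow_le_pow_left₀ (norm_nonneg _) hhlam 2)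
  simp only [add_zero] at h2
  have hfm : Measurable fun x => fhat m ω x + bhat m ω :=
    ((hk.continuous_coe (fhat m ω)).add_const _).measurable
  have hfB : ∀ x, |fhat m ω x + bhat m ω| ≤ K * ‖fhat m ω‖ + |bhat m ω| := fun x =>
    (abs_add_le _ _).trans (by gcongr; exact hk.abs_apply_le _ x)
  have hrisk := hℓ.risk_eq P (hℓ.integrable_lossFn P hfm hfB (rhohat m ω))
  have h3 := optRisk_le P ℓ hfm (rhohat m ω)
  rw [hrisk, ← EReal.coe_toReal (hℓ.optRisk_ne_top (P := P)) (hℓ.optRisk_ne_bot hP),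
    EReal.coe_le_coe_iff] at h3
  simp only [Set.mem_ofPred_eq, hrisk, EReal.toReal_coe, Real.dist_eq] at hω
  rw [abs_of_nonneg (by linarith)] at hω
  linarith

end Convergence

end SurrogateRisk

end

theorem mainTheorem3
    {X : Type*} [MetricSpace X] [CompactSpace X] [MeasurableSpace X] [BorelSpace X]
    {H : Type*} [NormedAddCommGroup H] [InnerProductSpace ℝ H] [CompleteSpace H] [RKHS ℝ H X ℝ]
    (K : ℝ) (hk : SurrogateRisk.IsUniversalKernel H K)
    (P : Measure (X × Bool)) [IsProbabilityMeasure P]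
    (hP : SurrogateRisk.IsNonDeterministic P)
    (ℓ : ℝ → ℝ) (hℓ : SurrogateRisk.IsBasicLoss ℓ)
    (lam : ℕ → ℝ) (hlam_pos : ∀ m, 0 < lam m) (hlam : Tendsto lam atTop atTop)
    {Ω : Type*} [MeasurableSpace Ω] (μ : Measure Ω) [IsProbabilityMeasure μ]
    (Z : ℕ → Ω → X × Bool) (hZ_meas : ∀ i, Measurable (Z i))
    (hZ_indep : iIndepFun Z μ) (hZ_law : ∀ i, μ.map (Z i) = P) :
    -- the optimal risk is finite
    (SurrogateRisk.optRisk P ℓ ≠ ⊥ ∧ SurrogateRisk.optRisk P ℓ ≠ ⊤) ∧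
    -- a constant `C` bounding the estimator with high probability exists
    (∃ C : ℝ, 0 < C ∧ ∃ c : ℝ, 0 < c ∧ ∃ M : ℕ,
      ∀ (fhat : ℕ → Ω → H) (bhat rhohat : ℕ → Ω → ℝ),
        SurrogateRisk.IsEstimator Z ℓ lam fhat bhat rhohat →
          SurrogateRisk.EstimatorBound μ lam C c M fhat bhat rhohat) ∧
    -- for every such `C`: if the uniform bound vanishes, then the risk converges in probability
    (∀ (fhat : ℕ → Ω → H) (bhat rhohat : ℕ → Ω → ℝ),
      SurrogateRisk.IsEstimator Z ℓ lam fhat bhat rhohat →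
      ∀ C : ℝ, 0 < C →
        (∃ c : ℝ, 0 < c ∧ ∃ M : ℕ,
          SurrogateRisk.EstimatorBound μ lam C c M fhat bhat rhohat) →
        ∀ κ : ℕ → ℝ, SurrogateRisk.IsLipschitzConst ℓ K C lam κ →
          (∀ ε : ℝ, 0 < ε →
            Tendsto (SurrogateRisk.uniformBound H ℓ K C lam κ ε) atTop (𝓝 0)) →
          TendstoInMeasure μ
            (fun m ω => (SurrogateRisk.risk P ℓ (fun x => fhat m ω x + bhat m ω)
              (rhohat m ω)).toReal)
            atTop (fun _ => (SurrogateRisk.optRisk P ℓ).toReal)) := by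
  refine ⟨⟨hℓ.optRisk_ne_bot hP, hℓ.optRisk_ne_top⟩,
    hk.exists_estimatorBound hP hℓ hlam_pos hlam hZ_meas hZ_indep hZ_law, ?_⟩
  rintro fhat bhat rhohat hest C hC ⟨c, hc, M, hbound⟩ κ hκ hunif
  exact hk.tendstoInMeasure_risk hP hℓ hlam_pos hlam hZ_meas hZ_indep hZ_law hest hC hc hbound
    hκ hunif
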